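/- Let $E$ be a finite set and let $(J_t,\xi_t)_{t\ge 0}$ be a càdlàg Markov additive process with values in $E\times\mathbb{R}$, adapted to a filtration $(\mathcal{F}_t)_{t\ge0}$: there are probability measures $\mathbb{P}_{\alpha,x}$, with expectations $\mathbb{E}_{\alpha,x}$, under which $(J_0,\xi_0)=(\alpha,x)$ almost surely, and, under each of them, for all nonnegative bounded continuous $f$ on $E\times\mathbb{R}$ and all $s,t\ge 0$, $$\mathbb{E}\left[f(J_{t+s},\xi_{t+s}-\xi_t)\mid\mathcal{F}_t\right]=\mathbb{E}_{J_t,0}\left[f(J_s,\xi_s)\right]\quad\text{a.s.}$$ Write $\mathbb{P}_\alpha=\mathbb{P}_{\alpha,0}$ and $\mathbb{E}_\alpha=\mathbb{E}_{\alpha,0}$. Assume that the Markov chain $J$ is irreducible, and let $Y_t=e^{\xi_t}$. For $z\in\mathbb{C}$, the matrix exponent $F(z)\in\mathbb{C}^{E\times E}$, where it exists, is the (unique) matrix such that, for all $t\ge0$ and $\alpha,\beta\in E$, $\mathbb{E}_\alpha[|e^{z\xi_t}|]<\infty$ and $$\mathbb{E}_\alpha\left[e^{z\xi_t};\,J_t=\beta\right]=\left(e^{tF(z)}\right)_{\alpha,\beta}.$$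 For an interest rate $r\in\mathbb{R}$ and a payoff function $H:\mathbb{R}^+\to\mathbb{R}$, where $\mathbb{R}^+=(0,\infty)$, the price of the European option with payoff $H$ and time to maturity $\tau\ge0$ in the state $(\alpha,y)\in E\times\mathbb{R}^+$ is $$C_H(\alpha,y,\tau)=e^{-r\tau}\,\mathbb{E}_{\alpha,\log y}\left[H(Y_\tau)\right].$$ The Mellin transform of $f:\mathbb{R}^+\to\mathbb{R}$ is $\{\mathcal{M}f\}(z)=\int_0^\infty x^{z-1}f(x)\,dx$; it is said to exist at $z$ if this Lebesgue integral converges absolutely. Let $T\ge0$ and $s\in\mathbb{R}$ be such that $\mathbb{E}[Y_T^{-s}]<\infty$ for some initial condition $(J_0,Y_0)=(\alpha_0,y_0)\in E\times\mathbb{R}^+$, and such that $\{\mathcal{M}H\}(s)$ exists. Then, for every $\alpha\in E$, the price $C_H(\alpha,y,T)$ is well defined (that is, $\mathbb{E}_{\alpha,\log y}[|H(Y_T)|]<\infty$) for Lebesgue-almost every $y>0$, and, for every $z\in\mathbb{C}$ with $\operatorname{Re}(z)=s$, the matrix exponent $F(-z)$ exists if $T>0$, the Mellin transform of $y\mapsto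 C_H(\alpha,y,T)$ exists at $z$, and $$\left\{\mathcal{M}C_H(\alpha,\cdot,T)\right\}(z)=e^{-rT}\left\{\mathcal{M}H\right\}(z)\sum_{\beta\in E}\left(e^{TF(-z)}\right)_{\alpha,\beta},$$ where, for $T=0$, the matrix $e^{TF(-z)}$ is read as the identity matrix. -/

import Mathlib

open MeasureTheory Set Filter Topology
open scoped NNReal BoundedContinuousFunction

/-- A Markov additive process (MAP) `(J, ξ)` with values in `E × ℝ` (with `E` finite), adapted to
a filtration `ℱ`, together with the probability measures `P α x`, under which the process starts
from `(J 0, ξ 0) = (α, x)`. -/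
structure MarkovAdditiveProcess (E Ω : Type*) [MeasurableSpace E] [mΩ : MeasurableSpace Ω] where
  /-- the filtration -/
  ℱ : Filtration ℝ≥0 mΩ
  /-- the modulating component (the market regime) -/
  J : ℝ≥0 → Ω → E
  /-- the additive component (the log-price) -/
  ξ : ℝ≥0 → Ω → ℝ
  /-- `P α x` is the law under which `(J, ξ)` starts from `(α, x)` -/
  P : E → ℝ → Measure Ω
  isProbabilityMeasure : ∀ α x, IsProbabilityMeasure (P α x)
  adapted_J : ∀ t, Measurable[ℱ t] (J t)
  adapted_ξ : ∀ t, Measurable[ℱ t] (ξ t)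
  /-- paths of `J` are càdlàg, for the discrete topology of `E` -/
  rightCont_J : ∀ ω t, ∀ᶠ u in 𝓝[>] t, J u ω = J t ω
  leftLim_J : ∀ ω t, ∃ a, ∀ᶠ u in 𝓝[<] t, J u ω = a
  /-- paths of `ξ` are càdlàg -/
  rightCont_ξ : ∀ ω t, Tendsto (fun u => ξ u ω) (𝓝[>] t) (𝓝 (ξ t ω))
  leftLim_ξ : ∀ ω t, ∃ l : ℝ, Tendsto (fun u => ξ u ω) (𝓝[<] t) (𝓝 l)
  initial : ∀ α x, ∀ᵐ ω ∂(P α x), J 0 ω = α ∧ ξ 0 ω = x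
  /-- the Markov additive property: `E[f(J_{t+s}, ξ_{t+s} - ξ_t) | ℱ_t] = E_{J_t, 0}[f(J_s, ξ_s)]`
  for every nonnegative bounded continuous `f` on `E × ℝ` -/
  markovAdditive : ∀ (α : E) (x : ℝ) (f : E → ℝ →ᵇ ℝ), (∀ β u, 0 ≤ f β u) → ∀ t s : ℝ≥0,
    (P α x)[fun ω => f (J (t + s) ω) (ξ (t + s) ω - ξ t ω) | ℱ t]
      =ᵐ[P α x] fun ω => ∫ ω', f (J s ω') (ξ s ω') ∂(P (J t ω) 0)

namespace MarkovAdditiveProcess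

variable {E Ω : Type*} [MeasurableSpace E] [MeasurableSpace Ω]

/-- The Markov chain `J` is irreducible: every state is reached from every state with positive
probability. -/
def IsIrreducible (X : MarkovAdditiveProcess E Ω) : Prop :=
  ∀ α β : E, ∃ t : ℝ≥0, 0 < t ∧ 0 < X.P α 0 {ω | X.J t ω = β}

/-- The price process `Y_t = exp(ξ_t)`. -/
noncomputable def Y (X : MarkovAdditiveProcess E Ω) (t : ℝ≥0) (ω : Ω) : ℝ :=
  Real.exp (X.ξ t ω)

/-- The price `C_H(α, y, τ) = e^{-rτ} E_{(α, log y)}[H(Y_τ)]` of the European option with payoff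
`H` and time to maturity `τ`, when the current state is `(α, y)` and the interest rate is `r`. -/
noncomputable def europeanPrice (X : MarkovAdditiveProcess E Ω) (r : ℝ) (H : ℝ → ℝ)
    (α : E) (y : ℝ) (τ : ℝ≥0) : ℝ :=
  Real.exp (-r * τ) * ∫ ω, H (X.Y τ ω) ∂(X.P α (Real.log y))

/-- `A` is a matrix exponent of the MAP at `z`: `e^{z ξ_t}` has finite expectation from every
starting state, and `E[e^{z ξ_t}; J_t = β | J_0 = α, ξ_0 = 0] = (e^{tA})_{α,β}` for all
`t ≥ 0`. -/
def IsMatrixExponent [Fintype E] [DecidableEq E] (X : MarkovAdditiveProcess E Ω) (z : ℂ)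
    (A : Matrix E E ℂ) : Prop :=
  ∀ (t : ℝ≥0) (α : E), Integrable (fun ω => Complex.exp (z * (X.ξ t ω : ℂ))) (X.P α 0) ∧
    ∀ β : E, ∫ ω in {ω | X.J t ω = β}, Complex.exp (z * (X.ξ t ω : ℂ)) ∂(X.P α 0)
      = (NormedSpace.exp ((t : ℂ) • A) : Matrix E E ℂ) α β

/-- In a Banach algebra, `t ↦ exp (t a)` on `[0, ∞)` determines `a`. -/
theorem eq_of_exp_smul_eq {𝔸 : Type*} [NormedRing 𝔸] [NormedAlgebra ℝ 𝔸] [CompleteSpace 𝔸]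
    {a b : 𝔸} (h : ∀ t : ℝ, 0 ≤ t → NormedSpace.exp (t • a) = NormedSpace.exp (t • b)) :
    a = b := by
  have d : ∀ c : 𝔸,
      HasDerivWithinAt (fun u : ℝ => NormedSpace.exp (u • c)) c (Ici 0) 0 := fun c => by
    simpa using (hasDerivAt_exp_smul_const (𝕂 := ℝ) c (0 : ℝ)).hasDerivWithinAt (s := Ici 0)
  exact (uniqueDiffWithinAt_Ici (0 : ℝ)).eq_deriv _ (d a)
    ((d b).congr (fun t ht => h t ht) (h 0 le_rfl))

/-- A matrix exponent is determined by the process. -/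
theorem IsMatrixExponent.unique [Fintype E] [DecidableEq E] {X : MarkovAdditiveProcess E Ω}
    {z : ℂ} {A B : Matrix E E ℂ} (hA : X.IsMatrixExponent z A) (hB : X.IsMatrixExponent z B) :
    A = B := by
  have key : ∀ t : ℝ, 0 ≤ t → NormedSpace.exp (t • A) = NormedSpace.exp (t • B) := by
    intro t ht
    have h : NormedSpace.exp (((⟨t, ht⟩ : ℝ≥0) : ℂ) • A)
        = NormedSpace.exp (((⟨t, ht⟩ : ℝ≥0) : ℂ) • B) := by
      ext α β
      exact ((hA ⟨t, ht⟩ α).2 β).symm.trans ((hB ⟨t, ht⟩ α).2 β)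
    have e : ∀ C : Matrix E E ℂ, ((⟨t, ht⟩ : ℝ≥0) : ℂ) • C = t • C := fun C => by
      ext i j
      simp [Matrix.smul_apply]
    rwa [e A, e B] at h
  let _ : NormedRing (Matrix E E ℂ) := Matrix.linftyOpNormedRing
  let _ : NormedAlgebra ℝ (Matrix E E ℂ) := Matrix.linftyOpNormedAlgebra
  exact eq_of_exp_smul_eq key

open Classical in
/-- The matrix exponent `F(z)` of the MAP: the unique matrix with
`E_α[e^{z ξ_t}; J_t = β] = (e^{t F(z)})_{α,β}` for all `t ≥ 0` and all `α`, `β` (and `0` if there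
is none). -/
noncomputable def matrixExponent [Fintype E] [DecidableEq E] (X : MarkovAdditiveProcess E Ω)
    (z : ℂ) : Matrix E E ℂ :=
  if h : ∃ A, X.IsMatrixExponent z A then h.choose else 0

end MarkovAdditiveProcess

/-! The Markov additive property makes the increment of `ξ` independent of its starting value. Hence
under `P α (log y)`, for y > 0, the price at time T is distributed as e^u y, where u has the law ν =
Σ_β `stateLaw T α β`, which does not depend on y (`map_Y`). The option price is thus a
multiplicative mixture of `H`, and Fubini's theorem factors its Mellin transform into that of `H`
and ∫ e^{-zu} dν (`hasMellin_integral_exp_mul`). Absolute convergence involves only Re z = s.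

It remains to recognise ∫ e^{-zu} dν as a row sum of e^{TF(-z)}, so to show that F(-z) exists when T
> 0. The moment matrices M_t form a semigroup by Chapman–Kolmogorov (`stateLaw_add`). Finiteness
spreads from one row at time T to all entries and times, because M_{T-u}(α₀,γ) M_u(γ,β) ≤ M_T(α₀,β)
and irreducibility makes the first factor positive (`IsIrreducible.expMoment_ne_top`).

Right continuity at 0 is the delicate point, since no dominating function for e^{θξ_t} is at hand.
Fatou's lemma bounds the lower limits of the diagonal entries below by 1, and for finite nonnegative
semigroups this already forces convergence to the identity (`tendsto_one_of_one_le_liminf_diag`).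
Scheffé's lemma carries the convergence over to complex moments, and a matrix semigroup right
continuous at 0 is an exponential (`exists_eq_exp_of_semigroup`). -/

/-! ### One-parameter semigroups in a Banach algebra -/

/-- A one-parameter semigroup in a Banach algebra which is right continuous at `0` is continuous
on `[0, ∞)`. -/
theorem continuousOn_of_semigroup {𝔸 : Type*} [NormedRing 𝔸] [CompleteSpace 𝔸] {m : ℝ → 𝔸}
    (hadd : ∀ s t, 0 ≤ s → 0 ≤ t → m (s + t) = m s * m t)
    (hm : Tendsto m (𝓝[>] 0) (𝓝 1)) : ContinuousOn m (Ici 0) := by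
  have hinv : Tendsto (fun h => Ring.inverse (m h)) (𝓝[>] 0) (𝓝 1) := by
    have := (NormedRing.inverse_continuousAt (1 : 𝔸ˣ)).tendsto.comp hm
    simpa [Function.comp_def] using this
  have hunit : ∀ᶠ h in 𝓝[>] (0 : ℝ), IsUnit (m h) :=
    hm.eventually (Units.isOpen.mem_nhds (isUnit_one))
  intro t ht
  have ht0 : (0 : ℝ) ≤ t := ht
  have hright : ContinuousWithinAt m (Ioi t) t := by
    have h1 : Tendsto (fun u => u - t) (𝓝[>] t) (𝓝[>] 0) := by
      refine tendsto_nhdsWithin_iff.2 ⟨?_, ?_⟩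
      · have : Tendsto (fun u : ℝ => u - t) (𝓝 t) (𝓝 (t - t)) :=
          Continuous.tendsto (by fun_prop) t
        rw [sub_self] at this
        exact this.mono_left nhdsWithin_le_nhds
      · filter_upwards [self_mem_nhdsWithin] with u hu
        exact sub_pos.2 (mem_Ioi.1 hu)
    have h2 := (hm.comp h1).const_mul (m t)
    rw [mul_one] at h2
    refine h2.congr' ?_
    filter_upwards [self_mem_nhdsWithin] with u hu
    rw [Function.comp, ← hadd t (u - t) ht0 (sub_pos.2 hu).le]
    congr 1; ring
  -- For u < t near t the factor m (t - u) is close to 1, hence invertible, and m u = m t * (m (t -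
  -- u))⁻¹.
  have hleft : ContinuousWithinAt m (Ico 0 t) t := by
    have h1 : Tendsto (fun u => t - u) (𝓝[Ico 0 t] t) (𝓝[>] 0) := by
      refine tendsto_nhdsWithin_iff.2 ⟨?_, ?_⟩
      · have : Tendsto (fun u : ℝ => t - u) (𝓝 t) (𝓝 (t - t)) :=
          Continuous.tendsto (by fun_prop) t
        rw [sub_self] at this
        exact this.mono_left nhdsWithin_le_nhds
      · filter_upwards [self_mem_nhdsWithin] with u hu
        exact sub_pos.2 hu.2
    have h2 := (hinv.comp h1).const_mul (m t)
    rw [mul_one] at h2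
    refine h2.congr' ?_
    filter_upwards [self_mem_nhdsWithin, h1.eventually hunit] with u hu hu'
    have h3 : m t = m u * m (t - u) := by
      rw [← hadd u (t - u) hu.1 (sub_pos.2 hu.2).le]
      congr 1; ring
    rw [Function.comp, h3, Ring.mul_inverse_cancel_right _ _ hu']
  have h4 : Ici (0 : ℝ) ⊆ insert t (Ico 0 t ∪ Ioi t) := by
    intro u hu
    rcases lt_trichotomy u t with h | h | h
    · exact Or.inr (Or.inl ⟨hu, h⟩)
    · exact Or.inl h
    · exact Or.inr (Or.inr h)
  exact ((hleft.union hright).insert).mono h4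

/-- A one-parameter semigroup in a Banach algebra which is right continuous at `0` is of the form
`t ↦ exp (t a)`. -/
theorem exists_eq_exp_of_semigroup {𝔸 : Type*} [NormedRing 𝔸] [NormedAlgebra ℝ 𝔸]
    [CompleteSpace 𝔸] {m : ℝ → 𝔸}
    (h0 : m 0 = 1) (hadd : ∀ s t, 0 ≤ s → 0 ≤ t → m (s + t) = m s * m t)
    (hm : Tendsto m (𝓝[>] 0) (𝓝 1)) :
    ∃ a : 𝔸, ∀ t, 0 ≤ t → m t = NormedSpace.exp (t • a) := by
  have hc := continuousOn_of_semigroup hadd hm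
  -- Freezing m at its value at 0 on the negative axis gives a function continuous on all of ℝ, so
  -- its primitive is differentiable everywhere.
  set n : ℝ → 𝔸 := fun t => m (max t 0) with hn
  have hnc : Continuous n := hc.comp_continuous (by fun_prop) fun t => le_max_right t 0
  have hnm : ∀ t, 0 ≤ t → n t = m t := fun t ht => by simp [hn, ht]
  set I : ℝ → 𝔸 := fun x => ∫ u in (0 : ℝ)..x, n u with hI
  have hId : ∀ x, HasDerivAt I (n x) x := fun x => hnc.integral_hasStrictDerivAt 0 x |>.hasDerivAt
  -- The quotient I h / h tends to m 0 = 1, and the units form an open set.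
  obtain ⟨h, hh, hV⟩ : ∃ h : ℝ, 0 < h ∧ IsUnit (I h) := by
    have h1 := (hasDerivAt_iff_tendsto_slope.1 (hId 0)).mono_left
      (nhdsWithin_mono (0 : ℝ) (fun x (hx : x ∈ Ioi (0 : ℝ)) => (ne_of_gt hx : x ≠ 0)))
    rw [hnm 0 le_rfl, h0] at h1
    obtain ⟨h, hu, hh⟩ := ((h1.eventually (Units.isOpen.mem_nhds isUnit_one)).and
      self_mem_nhdsWithin).exists
    have hh : (0 : ℝ) < h := hh
    refine ⟨h, hh, ?_⟩
    have h2 : slope I 0 h = h⁻¹ • I h := by simp [slope, hI]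
    have hu' : IsUnit (slope I 0 h) := hu
    rw [h2] at hu'
    have h3 := hu'.smul (Units.mk0 h hh.ne')
    simpa [Units.smul_def, smul_smul, hh.ne'] using h3
  obtain ⟨V, hV⟩ := hV
  have key : ∀ t, 0 ≤ t → m t * I h = I (t + h) - I t := by
    intro t ht
    have e1 : I (t + h) - I t = ∫ u in t..(t + h), n u := by
      rw [hI]
      exact intervalIntegral.integral_interval_sub_left (hnc.intervalIntegrable _ _)
        (hnc.intervalIntegrable _ _)
    have e2 : ∫ u in t..(t + h), n u = ∫ u in (0 : ℝ)..h, n (t + u) := by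
      rw [intervalIntegral.integral_comp_add_left]; simp
    rw [e1, e2, hI]
    have e3 := (ContinuousLinearMap.mul ℝ 𝔸 (m t)).intervalIntegral_comp_comm
      (hnc.intervalIntegrable (μ := volume) 0 h)
    simp only [ContinuousLinearMap.mul_apply'] at e3
    rw [← e3]
    refine intervalIntegral.integral_congr fun u hu => ?_
    rw [uIcc_of_le hh.le] at hu
    rw [hnm u hu.1, hnm (t + u) (by linarith [hu.1]), hadd t u ht hu.1]
  set W : 𝔸 := ((V⁻¹ : 𝔸ˣ) : 𝔸) with hW
  have hVW : I h * W = 1 := by rw [← hV, hW]; simp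
  set g : ℝ → 𝔸 := fun t => (I (t + h) - I t) * W with hg
  have hgm : ∀ t, 0 ≤ t → g t = m t := fun t ht => by
    rw [hg]; simp only; rw [← key t ht, mul_assoc, hVW, mul_one]
  -- Differentiating m t * I h = I (t + h) - I t gives m' t * I h = m t * (m h - 1), which dictates
  -- the generator.
  set a : 𝔸 := (m h - 1) * W with ha
  have hgd : ∀ t, 0 ≤ t → HasDerivAt g (g t * a) t := by
    intro t ht
    have d1 : HasDerivAt g ((n (t + h) - n t) * W) t :=
      (((hId (t + h)).comp_add_const t h).sub (hId t)).mul_const W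
    convert! d1 using 1
    rw [hgm t ht, hnm t ht, hnm (t + h) (by linarith), hadd t h ht hh.le, ha]
    noncomm_ring
  refine ⟨a, fun t ht => ?_⟩
  have hfd : ∀ u, 0 ≤ u → HasDerivAt (fun u : ℝ => g u * NormedSpace.exp (u • (-a))) 0 u := by
    intro u hu
    have d2 := (hgd u hu).mul (hasDerivAt_exp_smul_const' (𝕂 := ℝ) (-a) u)
    convert! d2 using 1
    noncomm_ring
  have hconst := constant_of_has_deriv_right_zero (a := (0 : ℝ)) (b := t)
    (f := fun u : ℝ => g u * NormedSpace.exp (u • (-a)))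
    (fun u hu => (hfd u hu.1).continuousAt.continuousWithinAt)
    (fun u hu => (hfd u hu.1).hasDerivWithinAt) t ⟨ht, le_rfl⟩
  simp only [zero_smul, NormedSpace.exp_zero, mul_one] at hconst
  rw [hgm 0 le_rfl, h0, hgm t ht] at hconst
  have hinv : NormedSpace.exp (t • (-a)) * NormedSpace.exp (t • a) = 1 := by
    let _ : NormedAlgebra ℚ 𝔸 := NormedAlgebra.restrictScalars ℚ ℝ 𝔸
    rw [← NormedSpace.exp_add_of_commute]
    · simp
    · rw [smul_neg]; exact (Commute.refl _).neg_left
  calc m t = m t * (NormedSpace.exp (t • (-a)) * NormedSpace.exp (t • a)) := by rw [hinv, mul_one]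
    _ = _ := by rw [← mul_assoc, hconst, one_mul]

/-! ### Scheffé's lemma -/

/-- **Scheffé's lemma**: almost everywhere convergence and convergence of the norms give
convergence of the integrals. -/
theorem tendsto_integral_of_tendsto_lintegral_enorm {ι Ω G : Type*} [MeasurableSpace Ω]
    [NormedAddCommGroup G] [NormedSpace ℝ G] {μ : Measure Ω} {l : Filter ι}
    [l.IsCountablyGenerated] {F : ι → Ω → G} {f : Ω → G}
    (hF : ∀ i, AEStronglyMeasurable (F i) μ) (hf : Integrable f μ)
    (hlim : ∀ᵐ ω ∂μ, Tendsto (fun i => F i ω) l (𝓝 (f ω)))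
    (hnorm : Tendsto (fun i => ∫⁻ ω, ‖F i ω‖ₑ ∂μ) l (𝓝 (∫⁻ ω, ‖f ω‖ₑ ∂μ))) :
    Tendsto (fun i => ∫ ω, F i ω ∂μ) l (𝓝 (∫ ω, f ω ∂μ)) := by
  have hA : ∫⁻ ω, ‖f ω‖ₑ ∂μ ≠ ⊤ := hf.2.ne
  set A := ∫⁻ ω, ‖f ω‖ₑ ∂μ with hAdef
  have hfin : ∀ᶠ i in l, ∫⁻ ω, ‖F i ω‖ₑ ∂μ < ⊤ := hnorm.eventually (gt_mem_nhds hA.lt_top)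
  refine tendsto_integral_of_L1 f hf.1 (hfin.mono fun i hi => ⟨hF i, hi⟩) ?_
  -- Nonnegative by the triangle inequality and converging a.e. to 2‖f‖: Fatou's lemma for this
  -- function bounds the L¹ distance from above.
  set g : ι → Ω → ENNReal := fun i ω => ‖F i ω‖ₑ + ‖f ω‖ₑ - ‖F i ω - f ω‖ₑ with hg
  have hgm : ∀ i, AEMeasurable (g i) μ := fun i =>
    ((hF i).enorm.add hf.1.enorm).sub ((hF i).sub hf.1).enorm
  have hsum : ∀ i, ∫⁻ ω, g i ω ∂μ + ∫⁻ ω, ‖F i ω - f ω‖ₑ ∂μ = ∫⁻ ω, ‖F i ω‖ₑ ∂μ + A := by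
    intro i
    rw [← lintegral_add_left' (hgm i), hAdef, ← lintegral_add_left' (hF i).enorm]
    exact lintegral_congr fun ω => tsub_add_cancel_of_le (enorm_sub_le)
  have hfatou : A + A ≤ liminf (fun i => ∫⁻ ω, g i ω ∂μ) l := by
    rcases l.eq_or_neBot with rfl | hl
    · simp [liminf, limsInf]
    refine le_trans (le_of_eq ?_) (lintegral_liminf_le' hgm)
    rw [hAdef, ← lintegral_add_left' hf.1.enorm]
    refine lintegral_congr_ae (hlim.mono fun ω hω => ?_)
    have h1 : Tendsto (fun i => ‖F i ω - f ω‖ₑ) l (𝓝 0) := by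
      have := (hω.sub_const (f ω)).enorm
      simpa using this
    have h2 := ENNReal.Tendsto.sub (hω.enorm.add_const ‖f ω‖ₑ) h1 (Or.inr ENNReal.zero_ne_top)
    rw [tsub_zero] at h2
    exact h2.liminf_eq.symm
  have hmin : Tendsto (fun i => min (∫⁻ ω, g i ω ∂μ) (A + A)) l (𝓝 (A + A)) := by
    refine tendsto_order.2 ⟨fun c hc => ?_, fun c hc => ?_⟩
    · filter_upwards [eventually_lt_of_lt_liminf (hc.trans_le hfatou)] with i hi
      exact lt_min hi hc
    · exact Eventually.of_forall fun i => (min_le_right _ _).trans_lt hc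
  have hAA : A + A ≠ ⊤ := ENNReal.add_ne_top.2 ⟨hA, hA⟩
  have hup := ENNReal.Tendsto.sub (hnorm.add_const A) hmin (Or.inl hAA)
  rw [tsub_self] at hup
  refine tendsto_of_tendsto_of_tendsto_of_le_of_le' tendsto_const_nhds hup
    (Eventually.of_forall fun i => zero_le) (hfin.mono fun i hi => ?_)
  have hgfin : ∫⁻ ω, g i ω ∂μ ≠ ⊤ := by
    refine ne_top_of_le_ne_top ?_ (le_self_add.trans_eq (hsum i))
    exact ENNReal.add_ne_top.2 ⟨hi.ne, hA⟩
  calc ∫⁻ ω, ‖F i ω - f ω‖ₑ ∂μ = ∫⁻ ω, ‖F i ω‖ₑ ∂μ + A - ∫⁻ ω, g i ω ∂μ :=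
        ENNReal.eq_sub_of_add_eq hgfin (by rw [add_comm]; exact hsum i)
    _ ≤ _ := tsub_le_tsub_left (min_le_left _ _) _

/-! ### Semigroups of nonnegative matrices -/

/-- A semigroup of finite nonnegative matrices whose diagonal entries have lower limit at least `1`
at `0` converges to the identity matrix at `0`. -/
theorem tendsto_one_of_one_le_liminf_diag {E : Type*} [Fintype E] [DecidableEq E]
    {M : ℝ≥0 → Matrix E E ENNReal} (hadd : ∀ t u, M (t + u) = M t * M u)
    (hfin : ∀ t α β, M t α β ≠ ⊤) (hdiag : ∀ α, 1 ≤ liminf (fun t => M t α α) (𝓝[>] 0))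
    (α β : E) : Tendsto (fun t => M t α β) (𝓝[>] 0) (𝓝 ((1 : Matrix E E ENNReal) α β)) := by
  set L : Matrix E E ENNReal := fun α β => limsup (fun t => M t α β) (𝓝[>] 0) with hL
  -- For 0 < t < u small, M u α β ≥ M t α β * M (u - t) β β ≥ c * M t α β; then take the upper limit
  -- in t. This yields both finiteness of L and existence of the limit.
  have key : ∀ c < (1 : ENNReal), ∀ α β, ∀ᶠ u in 𝓝[>] (0 : ℝ≥0), c * L α β ≤ M u α β := by
    intro c hc α β
    obtain ⟨δ, hδ, hδ'⟩ := mem_nhdsGT_iff_exists_Ioo_subset.1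
      (eventually_lt_of_lt_liminf (hc.trans_le (hdiag β)))
    filter_upwards [Ioo_mem_nhdsGT hδ] with u hu
    rw [← ENNReal.limsup_const_mul_of_ne_top (hc.trans ENNReal.one_lt_top).ne]
    refine limsup_le_of_le (by isBoundedDefault) ?_
    filter_upwards [Ioo_mem_nhdsGT hu.1] with t ht
    have h1 : c < M (u - t) β β := hδ' ⟨tsub_pos_of_lt ht.2, tsub_le_self.trans_lt hu.2⟩
    calc c * M t α β ≤ M (u - t) β β * M t α β := by gcongr
      _ = M t α β * M (u - t) β β := mul_comm _ _
      _ ≤ ∑ γ, M t α γ * M (u - t) γ β :=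
        Finset.single_le_sum (f := fun γ => M t α γ * M (u - t) γ β) (fun _ _ => zero_le)
          (Finset.mem_univ β)
      _ = M u α β := by
        rw [← Matrix.mul_apply, ← hadd, add_tsub_cancel_of_le ht.2.le]
  have hLfin : ∀ α β, L α β ≠ ⊤ := by
    intro α β h
    obtain ⟨u, hu⟩ := (key 2⁻¹ (by simp) α β).exists
    rw [h, ENNReal.mul_top (by simp)] at hu
    exact hfin u α β (top_le_iff.1 hu)
  have hLlim : ∀ α β, L α β ≤ liminf (fun t => M t α β) (𝓝[>] 0) := by
    intro α β
    refine ENNReal.le_of_forall_lt_one_mul_le fun c hc => ?_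
    exact le_liminf_of_le (by isBoundedDefault) (key c hc α β)
  have hlim : ∀ α β, Tendsto (fun t => M t α β) (𝓝[>] 0) (𝓝 (L α β)) := fun α β =>
    tendsto_of_le_liminf_of_limsup_le (hLlim α β) le_rfl
  have hidem : ∀ α β, L α β = ∑ γ, L α γ * L γ β := by
    intro α β
    have h1 : Tendsto (fun t : ℝ≥0 => t + t) (𝓝[>] 0) (𝓝[>] 0) := by
      refine tendsto_nhdsWithin_iff.2 ⟨?_, ?_⟩
      · have : Tendsto (fun t : ℝ≥0 => t + t) (𝓝 0) (𝓝 (0 + 0)) :=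
          Continuous.tendsto (by fun_prop) 0
        rw [add_zero] at this
        exact this.mono_left nhdsWithin_le_nhds
      · filter_upwards [self_mem_nhdsWithin] with u hu
        exact add_pos (mem_Ioi.1 hu) (mem_Ioi.1 hu)
    have h2 : Tendsto (fun t => M (t + t) α β) (𝓝[>] 0) (𝓝 (∑ γ, L α γ * L γ β)) := by
      simp_rw [hadd, Matrix.mul_apply]
      exact tendsto_finsetSum _ fun γ _ => ENNReal.Tendsto.mul (hlim α γ) (Or.inr (hLfin γ β))
        (hlim γ β) (Or.inr (hLfin α γ))
    exact tendsto_nhds_unique ((hlim α β).comp h1) h2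
  have hdiag' : ∀ α, 1 ≤ L α α := fun α => (hdiag α).trans_eq (hlim α α).liminf_eq
  -- L is idempotent with diagonal at least 1, so the terms γ = α and γ = β alone give L α β ≥ 2 L α
  -- β.
  have hoff : ∀ α β, α ≠ β → L α β = 0 := by
    intro α β hαβ
    have h1 : L α β + L α β ≤ L α β := by
      conv_rhs => rw [hidem α β]
      calc L α β + L α β ≤ L α α * L α β + L α β * L β β := by
            gcongr
            · exact le_mul_of_one_le_left zero_le (hdiag' α)
            · exact le_mul_of_one_le_right zero_le (hdiag' β)
        _ = ∑ γ ∈ {α, β}, L α γ * L γ β :=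
          (Finset.sum_pair (f := fun γ => L α γ * L γ β) hαβ).symm
        _ ≤ _ := Finset.sum_le_sum_of_subset (Finset.subset_univ _)
    by_contra h0
    exact absurd h1 (not_le.2 (ENNReal.lt_add_right (hLfin α β) h0))
  have hone : ∀ α, L α α = 1 := by
    intro α
    have h1 : L α α = L α α * L α α := by
      conv_lhs => rw [hidem α α]
      refine Finset.sum_eq_single α (fun γ _ hγ => ?_) (by simp)
      rw [hoff γ α hγ, mul_zero]
    have h2 : L α α ≠ 0 := fun h => by simpa [h] using hdiag' α
    have h3 : L α α * 1 = L α α * L α α := by rw [mul_one]; exact h1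
    exact ((ENNReal.mul_right_inj h2 (hLfin α α)).1 h3).symm
  have hL1 : (1 : Matrix E E ENNReal) α β = L α β := by
    rcases eq_or_ne α β with rfl | h
    · rw [hone, Matrix.one_apply_eq]
    · rw [hoff α β h, Matrix.one_apply_ne h]
  rw [hL1]
  exact hlim α β

/-! ### Laws of the increments and the Chapman–Kolmogorov equation. -/

namespace MarkovAdditiveProcess

section Laws

variable {E Ω : Type*} [MeasurableSpace E] [MeasurableSpace Ω]

instance (X : MarkovAdditiveProcess E Ω) (α : E) (x : ℝ) : IsProbabilityMeasure (X.P α x) :=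
  X.isProbabilityMeasure α x

@[fun_prop]
theorem measurable_J (X : MarkovAdditiveProcess E Ω) (t : ℝ≥0) : Measurable (X.J t) :=
  (X.adapted_J t).mono (X.ℱ.le t) le_rfl

@[fun_prop]
theorem measurable_ξ (X : MarkovAdditiveProcess E Ω) (t : ℝ≥0) : Measurable (X.ξ t) :=
  (X.adapted_ξ t).mono (X.ℱ.le t) le_rfl

theorem measurableSet_J_eq [MeasurableSingletonClass E] (X : MarkovAdditiveProcess E Ω) (t : ℝ≥0)
    (β : E) : MeasurableSet {ω | X.J t ω = β} :=
  X.measurable_J t (measurableSet_singleton β)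

/-- The law of `ξ_t` on the event `J_t = β`, for the process started from `(α, 0)`. -/
noncomputable def stateLaw (X : MarkovAdditiveProcess E Ω) (t : ℝ≥0) (α β : E) : Measure ℝ :=
  ((X.P α 0).restrict {ω | X.J t ω = β}).map (X.ξ t)

instance (X : MarkovAdditiveProcess E Ω) (t : ℝ≥0) (α β : E) :
    IsFiniteMeasure (X.stateLaw t α β) := by
  unfold stateLaw; infer_instance

/-- Integrate the Markov additive property over D with the test function g(u) 1_{β' = β}: since `J
t` = γ on D, the right-hand side is constant there. -/
theorem setIntegral_increment [Fintype E] [DecidableEq E] [MeasurableSingletonClass E]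
    (X : MarkovAdditiveProcess E Ω) {α β γ : E} {x : ℝ} {t s : ℝ≥0} {D : Set Ω}
    (hD : MeasurableSet[X.ℱ t] D) (hDγ : D ⊆ {ω | X.J t ω = γ}) (g : ℝ →ᵇ ℝ) (hg : ∀ u, 0 ≤ g u) :
    ∫ ω in D ∩ {ω | X.J (t + s) ω = β}, g (X.ξ (t + s) ω - X.ξ t ω) ∂(X.P α x)
      = (X.P α x).real D * ∫ u, g u ∂(X.stateLaw s γ β) := by
  set f : E → ℝ →ᵇ ℝ := fun β' => if β' = β then g else 0 with hf
  have hfg : ∀ β' u, f β' u = if β' = β then g u else 0 := fun β' u => by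
    simp only [hf]; split_ifs <;> rfl
  have hf0 : ∀ β' u, 0 ≤ f β' u := fun β' u => by
    rw [hfg]; split_ifs
    · exact hg u
    · exact le_rfl
  have hind : ∀ (q : ℝ≥0) (h : Ω → ℝ), (fun ω => f (X.J q ω) (h ω))
      = {ω | X.J q ω = β}.indicator (fun ω => g (h ω)) := fun q h => by
    ext ω; simp [hfg, indicator]
  have hgm : Measurable g := g.continuous.measurable
  have hint : Integrable (fun ω => f (X.J (t + s) ω) (X.ξ (t + s) ω - X.ξ t ω)) (X.P α x) := by
    rw [hind (t + s) fun ω => X.ξ (t + s) ω - X.ξ t ω]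
    refine Integrable.indicator ?_ (X.measurableSet_J_eq _ _)
    refine Integrable.of_bound (by fun_prop) ‖g‖ (Eventually.of_forall fun ω => g.norm_coe_le_norm _)
  have hD' : MeasurableSet D := X.ℱ.le t D hD
  calc ∫ ω in D ∩ {ω | X.J (t + s) ω = β}, g (X.ξ (t + s) ω - X.ξ t ω) ∂(X.P α x)
      = ∫ ω in D, f (X.J (t + s) ω) (X.ξ (t + s) ω - X.ξ t ω) ∂(X.P α x) := by
        rw [hind (t + s) fun ω => X.ξ (t + s) ω - X.ξ t ω,
          setIntegral_indicator (X.measurableSet_J_eq _ _)]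
    _ = ∫ ω in D, ((X.P α x)[fun ω => f (X.J (t + s) ω) (X.ξ (t + s) ω - X.ξ t ω) | X.ℱ t]) ω
          ∂(X.P α x) := (setIntegral_condExp (X.ℱ.le t) hint hD).symm
    _ = ∫ ω in D, (∫ ω', f (X.J s ω') (X.ξ s ω') ∂(X.P (X.J t ω) 0)) ∂(X.P α x) :=
        integral_congr_ae (ae_restrict_of_ae (X.markovAdditive α x f hf0 t s))
    _ = ∫ ω in D, (∫ ω', f (X.J s ω') (X.ξ s ω') ∂(X.P γ 0)) ∂(X.P α x) :=
        setIntegral_congr_fun hD' fun ω hω => by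
          have : X.J t ω = γ := hDγ hω
          simp only [this]
    _ = (X.P α x).real D * ∫ ω', f (X.J s ω') (X.ξ s ω') ∂(X.P γ 0) := by
        rw [setIntegral_const, smul_eq_mul]
    _ = _ := by
        rw [hind s (X.ξ s), integral_indicator (X.measurableSet_J_eq _ _), stateLaw,
          integral_map (by fun_prop) (by fun_prop)]

/-- The **Markov additive property** for laws. -/
theorem map_increment [Fintype E] [DecidableEq E] [MeasurableSingletonClass E]
    (X : MarkovAdditiveProcess E Ω) {α γ : E} (β : E) (x : ℝ) {t : ℝ≥0} (s : ℝ≥0) {D : Set Ω}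
    (hD : MeasurableSet[X.ℱ t] D) (hDγ : D ⊆ {ω | X.J t ω = γ}) :
    ((X.P α x).restrict (D ∩ {ω | X.J (t + s) ω = β})).map (fun ω => X.ξ (t + s) ω - X.ξ t ω)
      = (X.P α x) D • X.stateLaw s γ β := by
  have : IsFiniteMeasure ((X.P α x) D • X.stateLaw s γ β) :=
    Measure.smul_finite _ (measure_ne_top _ _)
  have key : ∀ g : ℝ →ᵇ ℝ, (∀ u, 0 ≤ g u) →
      ∫ u, g u ∂((X.P α x).restrict (D ∩ {ω | X.J (t + s) ω = β})).map
        (fun ω => X.ξ (t + s) ω - X.ξ t ω) = ∫ u, g u ∂((X.P α x) D • X.stateLaw s γ β) := by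
    intro g hg
    have hgm : Measurable g := g.continuous.measurable
    rw [integral_map (by fun_prop) (by fun_prop), X.setIntegral_increment hD hDγ g hg,
      integral_smul_measure, smul_eq_mul]
    rfl
  refine ext_of_forall_integral_eq_of_IsFiniteMeasure fun f => ?_
  -- The Markov property is given for nonnegative test functions only, so f is shifted by its norm.
  have h1 := key (f + BoundedContinuousFunction.const ℝ ‖f‖) fun u => by
    have := neg_le_of_abs_le (f.norm_coe_le_norm u)
    simp only [BoundedContinuousFunction.coe_add, Pi.add_apply,
      BoundedContinuousFunction.const_apply]
    linarith
  have h2 := key (BoundedContinuousFunction.const ℝ ‖f‖) fun u => norm_nonneg f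
  simp only [BoundedContinuousFunction.coe_add, Pi.add_apply] at h1
  rw [integral_add (f.integrable _) (BoundedContinuousFunction.integrable _ _),
    integral_add (f.integrable _) (BoundedContinuousFunction.integrable _ _), h2] at h1
  exact add_right_cancel h1

/-- The **Chapman–Kolmogorov equation**. -/
theorem stateLaw_add [Fintype E] [DecidableEq E] [MeasurableSingletonClass E]
    (X : MarkovAdditiveProcess E Ω) (t s : ℝ≥0) (α β : E) :
    X.stateLaw (t + s) α β
      = ∑ γ, Measure.conv (X.stateLaw t α γ) (X.stateLaw s γ β) := by
  -- On `J t` = γ, position and later increment decouple: apply `map_increment` to D = {ξ_t ∈ A, J_t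
  -- = γ} and compare measures of rectangles.
  have hprod : ∀ γ, (X.stateLaw t α γ).prod (X.stateLaw s γ β)
      = ((X.P α 0).restrict ({ω | X.J t ω = γ} ∩ {ω | X.J (t + s) ω = β})).map
        (fun ω => (X.ξ t ω, X.ξ (t + s) ω - X.ξ t ω)) := by
    intro γ
    refine Measure.prod_eq fun A B hA hB => ?_
    have hD : MeasurableSet[X.ℱ t] (X.ξ t ⁻¹' A ∩ {ω | X.J t ω = γ}) :=
      (X.adapted_ξ t hA).inter (X.adapted_J t (measurableSet_singleton γ))
    have h := X.map_increment (α := α) β 0 s hD inter_subset_right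
    have h' := congrArg (fun μ : Measure ℝ => μ B) h
    simp only [Measure.smul_apply, smul_eq_mul] at h'
    rw [Measure.map_apply (by fun_prop) hB, Measure.restrict_apply
      ((show Measurable fun ω => X.ξ (t + s) ω - X.ξ t ω by fun_prop) hB)] at h'
    rw [Measure.map_apply (by fun_prop) (hA.prod hB), Measure.restrict_apply
      ((show Measurable fun ω => (X.ξ t ω, X.ξ (t + s) ω - X.ξ t ω) by fun_prop) (hA.prod hB)),
      stateLaw, Measure.map_apply (by fun_prop) hA,
      Measure.restrict_apply (X.measurable_ξ t hA), ← h']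
    congr 1
    ext ω
    simp only [mem_inter_iff, mem_preimage, mem_prod, mem_ofPred_eq]
    tauto
  have hconv : ∀ γ, Measure.conv (X.stateLaw t α γ) (X.stateLaw s γ β)
      = ((X.P α 0).restrict ({ω | X.J t ω = γ} ∩ {ω | X.J (t + s) ω = β})).map (X.ξ (t + s)) := by
    intro γ
    rw [Measure.conv, hprod, Measure.map_map (by fun_prop) (by fun_prop)]
    congr 1
    ext ω; simp
  simp_rw [hconv]
  ext B hB
  rw [Measure.finsetSum_apply, stateLaw, Measure.map_apply (by fun_prop) hB]
  have e : ∀ γ, ((X.P α 0).restrict ({ω | X.J t ω = γ} ∩ {ω | X.J (t + s) ω = β})).map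
      (X.ξ (t + s)) B = (((X.P α 0).restrict {ω | X.J (t + s) ω = β}).restrict
        (X.ξ (t + s) ⁻¹' B)) (X.J t ⁻¹' {γ}) := by
    intro γ
    rw [Measure.map_apply (by fun_prop) hB, Measure.restrict_apply (X.measurable_ξ _ hB),
      Measure.restrict_apply (X.measurable_J t (measurableSet_singleton γ)),
      Measure.restrict_apply ((X.measurable_J t (measurableSet_singleton γ)).inter (X.measurable_ξ _ hB))]
    congr 1
    ext ω
    simp only [mem_inter_iff, mem_preimage, mem_ofPred_eq, mem_singleton_iff]
    tauto
  simp_rw [e]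
  rw [sum_measure_preimage_singleton _ fun γ _ => X.measurableSet_J_eq t γ]
  simp

/-- Spatial homogeneity is the Markov additive property at time 0, applied on {J_0 = α}, which has
full probability. -/
theorem map_sub_initial [Fintype E] [DecidableEq E] [MeasurableSingletonClass E]
    (X : MarkovAdditiveProcess E Ω) (t : ℝ≥0) (α β : E) (x : ℝ) :
    ((X.P α x).restrict {ω | X.J t ω = β}).map (fun ω => X.ξ t ω - x) = X.stateLaw t α β := by
  have h := X.map_increment (α := α) (γ := α) (t := 0) β x t
    (X.adapted_J 0 (measurableSet_singleton α)) subset_rfl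
  have h1 : (X.P α x) (X.J 0 ⁻¹' {α}) = 1 :=
    (prob_compl_eq_zero_iff (X.measurableSet_J_eq 0 α)).1
      (by filter_upwards [X.initial α x] with ω hω using hω.1)
  rw [h1, one_smul, zero_add] at h
  rw [← h]
  have h2 : (X.P α x).restrict (X.J 0 ⁻¹' {α} ∩ {ω | X.J t ω = β})
      = (X.P α x).restrict {ω | X.J t ω = β} := by
    refine Measure.restrict_congr_set ?_
    filter_upwards [X.initial α x] with ω hω
    refine propext ⟨fun h => h.2, fun h => ⟨hω.1, h⟩⟩
  rw [h2]
  refine Measure.map_congr (ae_restrict_of_ae ?_)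
  filter_upwards [X.initial α x] with ω hω
  rw [hω.2]

theorem map_eq_sum_restrict [Fintype E] [DecidableEq E] [MeasurableSingletonClass E]
    (X : MarkovAdditiveProcess E Ω) (t : ℝ≥0) (α : E) (x : ℝ) {f : Ω → ℝ} (hf : Measurable f) :
    (X.P α x).map f = ∑ β, ((X.P α x).restrict {ω | X.J t ω = β}).map f := by
  ext B hB
  rw [Measure.finsetSum_apply, Measure.map_apply hf hB]
  have e : ∀ β, ((X.P α x).restrict {ω | X.J t ω = β}).map f B
      = ((X.P α x).restrict (f ⁻¹' B)) (X.J t ⁻¹' {β}) := by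
    intro β
    rw [Measure.map_apply hf hB, Measure.restrict_apply (hf hB),
      Measure.restrict_apply (X.measurable_J t (measurableSet_singleton β)), inter_comm]
    rfl
  simp_rw [e]
  rw [sum_measure_preimage_singleton _ fun γ _ => X.measurableSet_J_eq t γ]
  simp

theorem map_ξ_sub_initial [Fintype E] [DecidableEq E] [MeasurableSingletonClass E]
    (X : MarkovAdditiveProcess E Ω) (t : ℝ≥0) (α : E) (x : ℝ) :
    (X.P α x).map (fun ω => X.ξ t ω - x) = ∑ β, X.stateLaw t α β := by
  rw [X.map_eq_sum_restrict t α x (by fun_prop)]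
  exact Finset.sum_congr rfl fun β _ => X.map_sub_initial t α β x

theorem map_ξ_eq_sum [Fintype E] [DecidableEq E] [MeasurableSingletonClass E]
    (X : MarkovAdditiveProcess E Ω) (t : ℝ≥0) (α : E) :
    (X.P α 0).map (X.ξ t) = ∑ β, X.stateLaw t α β :=
  X.map_eq_sum_restrict t α 0 (by fun_prop)

end Laws

end MarkovAdditiveProcess

set_option linter.unusedSectionVars false

/-! ### Exponential moments and existence of the matrix exponent. -/

namespace MarkovAdditiveProcess

section Moments

variable {E Ω : Type*} [Fintype E] [DecidableEq E] [MeasurableSpace E] [MeasurableSingletonClass E]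
  [MeasurableSpace Ω]

/-- The matrix of exponential moments `E_α[e^{θ ξ_t}; J_t = β]`. -/
noncomputable def expMoment (X : MarkovAdditiveProcess E Ω) (θ : ℝ) (t : ℝ≥0) :
    Matrix E E ENNReal :=
  Matrix.of fun α β => ∫⁻ u, ENNReal.ofReal (Real.exp (θ * u)) ∂(X.stateLaw t α β)

/-- The matrix of complex exponential moments `E_α[e^{z ξ_t}; J_t = β]`. -/
noncomputable def cexpMoment (X : MarkovAdditiveProcess E Ω) (z : ℂ) (t : ℝ≥0) :
    Matrix E E ℂ :=
  Matrix.of fun α β => ∫ u : ℝ, Complex.exp (z * (u : ℂ)) ∂(X.stateLaw t α β)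

theorem expMoment_apply (X : MarkovAdditiveProcess E Ω) (θ : ℝ) (t : ℝ≥0) (α β : E) :
    X.expMoment θ t α β = ∫⁻ u, ENNReal.ofReal (Real.exp (θ * u)) ∂(X.stateLaw t α β) := rfl

theorem cexpMoment_apply (X : MarkovAdditiveProcess E Ω) (z : ℂ) (t : ℝ≥0) (α β : E) :
    X.cexpMoment z t α β = ∫ u : ℝ, Complex.exp (z * (u : ℂ)) ∂(X.stateLaw t α β) := rfl

theorem enorm_cexp_mul_ofReal (z : ℂ) (u : ℝ) :
    ‖Complex.exp (z * (u : ℂ))‖ₑ = ENNReal.ofReal (Real.exp (z.re * u)) := by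
  rw [← ofReal_norm, Complex.norm_exp]
  simp

theorem expMoment_add (X : MarkovAdditiveProcess E Ω) (θ : ℝ) (t s : ℝ≥0) :
    X.expMoment θ (t + s) = X.expMoment θ t * X.expMoment θ s := by
  ext α β
  rw [Matrix.mul_apply, expMoment_apply, stateLaw_add, lintegral_finsetSum_measure]
  refine Finset.sum_congr rfl fun γ _ => ?_
  rw [Measure.lintegral_conv (by fun_prop), expMoment_apply, expMoment_apply,
    ← lintegral_mul_const _ (by fun_prop)]
  refine lintegral_congr fun u => ?_
  rw [← lintegral_const_mul _ (by fun_prop)]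
  refine lintegral_congr fun v => ?_
  rw [mul_add, Real.exp_add, ENNReal.ofReal_mul (Real.exp_pos _).le]

theorem integrable_cexp_stateLaw (X : MarkovAdditiveProcess E Ω) {z : ℂ} {t : ℝ≥0} {α β : E}
    (h : X.expMoment z.re t α β ≠ ⊤) :
    Integrable (fun u : ℝ => Complex.exp (z * (u : ℂ))) (X.stateLaw t α β) := by
  refine ⟨by fun_prop, ?_⟩
  rw [HasFiniteIntegral]
  simp_rw [enorm_cexp_mul_ofReal]
  exact h.lt_top

theorem cexpMoment_add (X : MarkovAdditiveProcess E Ω) {z : ℂ}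
    (hfin : ∀ t α β, X.expMoment z.re t α β ≠ ⊤) (t s : ℝ≥0) :
    X.cexpMoment z (t + s) = X.cexpMoment z t * X.cexpMoment z s := by
  ext α β
  have hint := X.integrable_cexp_stateLaw (hfin (t + s) α β)
  rw [stateLaw_add, integrable_finsetSum_measure] at hint
  rw [Matrix.mul_apply, cexpMoment_apply, stateLaw_add, integral_finsetSum_measure hint]
  refine Finset.sum_congr rfl fun γ hγ => ?_
  rw [integral_conv (hint γ hγ), cexpMoment_apply, cexpMoment_apply, ← integral_mul_const]
  refine integral_congr_ae (Eventually.of_forall fun u => ?_)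
  simp only
  rw [← integral_const_mul]
  refine integral_congr_ae (Eventually.of_forall fun v => ?_)
  simp only
  rw [← Complex.exp_add]
  push_cast
  ring_nf

theorem expMoment_eq_lintegral (X : MarkovAdditiveProcess E Ω) (θ : ℝ) (t : ℝ≥0) (α β : E) :
    X.expMoment θ t α β = ∫⁻ ω in {ω | X.J t ω = β},
      ENNReal.ofReal (Real.exp (θ * X.ξ t ω)) ∂(X.P α 0) := by
  rw [expMoment_apply, stateLaw, lintegral_map (by fun_prop) (by fun_prop)]

theorem cexpMoment_eq_integral (X : MarkovAdditiveProcess E Ω) (z : ℂ) (t : ℝ≥0) (α β : E) :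
    X.cexpMoment z t α β = ∫ ω in {ω | X.J t ω = β},
      Complex.exp (z * (X.ξ t ω : ℂ)) ∂(X.P α 0) := by
  rw [cexpMoment_apply, stateLaw, integral_map (by fun_prop) (by fun_prop)]

/-- Right continuity of the paths at 0: `J` stays at α for a short time and ξ tends to 0. -/
theorem tendsto_indicator_cexp (X : MarkovAdditiveProcess E Ω) (z : ℂ) (α β : E) :
    ∀ᵐ ω ∂(X.P α 0), Tendsto (fun t => {ω | X.J t ω = β}.indicator
      (fun ω => Complex.exp (z * (X.ξ t ω : ℂ))) ω) (𝓝[>] 0)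
        (𝓝 ((1 : Matrix E E ℂ) α β)) := by
  filter_upwards [X.initial α 0] with ω hω
  have hξ : Tendsto (fun t => Complex.exp (z * (X.ξ t ω : ℂ))) (𝓝[>] 0) (𝓝 1) := by
    have h1 := X.rightCont_ξ ω 0
    rw [hω.2] at h1
    have h2 : Continuous fun u : ℝ => Complex.exp (z * (u : ℂ)) := by fun_prop
    simpa [Function.comp_def] using (h2.tendsto 0).comp h1
  rcases eq_or_ne α β with rfl | hαβ
  · rw [Matrix.one_apply_eq]
    refine hξ.congr' ?_
    filter_upwards [X.rightCont_J ω 0] with t ht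
    rw [indicator_of_mem]
    exact ht.trans hω.1
  · rw [Matrix.one_apply_ne hαβ]
    refine tendsto_const_nhds.congr' ?_
    filter_upwards [X.rightCont_J ω 0] with t ht
    rw [indicator_of_notMem]
    exact fun h => hαβ ((ht.trans hω.1).symm.trans h)

theorem expMoment_eq_lintegral_enorm (X : MarkovAdditiveProcess E Ω) (z : ℂ) (t : ℝ≥0) (α β : E) :
    X.expMoment z.re t α β = ∫⁻ ω, ‖{ω | X.J t ω = β}.indicator
      (fun ω => Complex.exp (z * (X.ξ t ω : ℂ))) ω‖ₑ ∂(X.P α 0) := by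
  rw [expMoment_eq_lintegral, ← lintegral_indicator (X.measurableSet_J_eq t β)]
  refine lintegral_congr fun ω => ?_
  rw [enorm_indicator_eq_indicator_enorm]
  simp_rw [enorm_cexp_mul_ofReal]

theorem aestronglyMeasurable_indicator_cexp (X : MarkovAdditiveProcess E Ω) (z : ℂ) (t : ℝ≥0)
    (β : E) (μ : Measure Ω) : AEStronglyMeasurable ({ω | X.J t ω = β}.indicator
      (fun ω => Complex.exp (z * (X.ξ t ω : ℂ)))) μ := by
  refine AEStronglyMeasurable.indicator (Measurable.aestronglyMeasurable ?_)
    (X.measurableSet_J_eq t β)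
  fun_prop

/-- Fatou's lemma along the pathwise limit; no finiteness of moments is needed. -/
theorem one_le_liminf_expMoment (X : MarkovAdditiveProcess E Ω) (θ : ℝ) (α : E) :
    1 ≤ liminf (fun t => X.expMoment θ t α α) (𝓝[>] 0) := by
  have h := X.expMoment_eq_lintegral_enorm (θ : ℂ)
  rw [Complex.ofReal_re] at h
  simp_rw [h]
  refine le_trans (le_of_eq ?_) (lintegral_liminf_le' fun t =>
    (X.aestronglyMeasurable_indicator_cexp (θ : ℂ) t α _).enorm)
  have h1 : ∫⁻ _, (1 : ENNReal) ∂(X.P α 0) = 1 := by simp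
  rw [← h1]
  refine lintegral_congr_ae ?_
  filter_upwards [X.tendsto_indicator_cexp (θ : ℂ) α α] with ω hω
  have := hω.enorm.liminf_eq
  rw [this]
  simp

theorem tendsto_expMoment (X : MarkovAdditiveProcess E Ω) {θ : ℝ}
    (hfin : ∀ t α β, X.expMoment θ t α β ≠ ⊤) (α β : E) :
    Tendsto (fun t => X.expMoment θ t α β) (𝓝[>] 0) (𝓝 ((1 : Matrix E E ENNReal) α β)) :=
  tendsto_one_of_one_le_liminf_diag (X.expMoment_add θ) hfin (X.one_le_liminf_expMoment θ) α β

/-- Scheffé's lemma: the integrands converge pathwise, and their norms integrate to the real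
moments, whose limit is known. -/
theorem tendsto_cexpMoment (X : MarkovAdditiveProcess E Ω) {z : ℂ}
    (hfin : ∀ t α β, X.expMoment z.re t α β ≠ ⊤) :
    Tendsto (X.cexpMoment z) (𝓝[>] 0) (𝓝 1) := by
  refine tendsto_pi_nhds.2 fun α => tendsto_pi_nhds.2 fun β => ?_
  have h1 := tendsto_integral_of_tendsto_lintegral_enorm (μ := X.P α 0)
    (f := fun _ => (1 : Matrix E E ℂ) α β)
    (fun t => X.aestronglyMeasurable_indicator_cexp z t β _) (integrable_const _)
    (X.tendsto_indicator_cexp z α β) (by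
      simp_rw [← X.expMoment_eq_lintegral_enorm]
      convert! X.tendsto_expMoment hfin α β using 2
      rcases eq_or_ne α β with rfl | hαβ
      · simp
      · simp [Matrix.one_apply_ne hαβ])
  simp_rw [integral_indicator (X.measurableSet_J_eq _ β), ← cexpMoment_eq_integral] at h1
  simpa using h1

theorem stateLaw_zero (X : MarkovAdditiveProcess E Ω) (α β : E) :
    X.stateLaw 0 α β = if α = β then Measure.dirac 0 else 0 := by
  rw [stateLaw, Measure.map_congr (g := fun _ => (0 : ℝ))
    (ae_restrict_of_ae ((X.initial α 0).mono fun ω hω => hω.2)), Measure.map_const,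
    Measure.restrict_apply MeasurableSet.univ, univ_inter]
  split_ifs with h
  · rw [(prob_compl_eq_zero_iff (X.measurableSet_J_eq 0 β)).1
      ((X.initial α 0).mono fun ω hω => hω.1.trans h), one_smul]
  · have : (X.P α 0) {ω | X.J 0 ω = β} = 0 :=
      measure_mono_null (fun ω (hω : X.J 0 ω = β) => fun h' => h (h'.1.symm.trans hω))
        (X.initial α 0)
    rw [this, zero_smul]

theorem cexpMoment_zero (X : MarkovAdditiveProcess E Ω) (z : ℂ) : X.cexpMoment z 0 = 1 := by
  ext α β
  rw [cexpMoment_apply, stateLaw_zero]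
  rcases eq_or_ne α β with rfl | h
  · simp
  · simp [h]

theorem isMatrixExponent_iff (X : MarkovAdditiveProcess E Ω) (z : ℂ) (A : Matrix E E ℂ) :
    X.IsMatrixExponent z A ↔ (∀ t α β, X.expMoment z.re t α β ≠ ⊤) ∧
      ∀ t : ℝ≥0, X.cexpMoment z t = NormedSpace.exp ((t : ℂ) • A) := by
  have hint : ∀ (t : ℝ≥0) (α : E), Integrable (fun ω => Complex.exp (z * (X.ξ t ω : ℂ))) (X.P α 0)
      ↔ ∀ β, X.expMoment z.re t α β ≠ ⊤ := by
    intro t α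
    have h1 : Integrable (fun ω => Complex.exp (z * (X.ξ t ω : ℂ))) (X.P α 0)
        ↔ Integrable (fun u : ℝ => Complex.exp (z * (u : ℂ))) ((X.P α 0).map (X.ξ t)) :=
      (integrable_map_measure (μ := X.P α 0) (f := X.ξ t)
        (g := fun u : ℝ => Complex.exp (z * (u : ℂ))) (by fun_prop) (by fun_prop)).symm
    rw [h1, map_ξ_eq_sum, integrable_finsetSum_measure]
    refine ⟨fun h β => ?_, fun h β _ => X.integrable_cexp_stateLaw (h β)⟩
    have h2 := (h β (Finset.mem_univ β)).2.ne
    simp_rw [enorm_cexp_mul_ofReal] at h2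
    exact h2
  constructor
  · intro h
    refine ⟨fun t α => (hint t α).1 (h t α).1, fun t => ?_⟩
    ext α β
    rw [cexpMoment_eq_integral, (h t α).2 β]
  · intro h t α
    refine ⟨(hint t α).2 (h.1 t α), fun β => ?_⟩
    rw [← cexpMoment_eq_integral, h.2 t]

open scoped Matrix.Norms.Operator in
/-- If all exponential moments of order `Re z` are finite, the matrix exponent exists at `z`. -/
theorem exists_isMatrixExponent (X : MarkovAdditiveProcess E Ω) {z : ℂ}
    (hfin : ∀ t α β, X.expMoment z.re t α β ≠ ⊤) : ∃ A, X.IsMatrixExponent z A := by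
  have htend : Tendsto (fun t : ℝ => t.toNNReal) (𝓝[>] 0) (𝓝[>] 0) := by
    refine tendsto_nhdsWithin_iff.2 ⟨?_, ?_⟩
    · have : Tendsto (fun t : ℝ => t.toNNReal) (𝓝 0) (𝓝 (Real.toNNReal 0)) :=
        continuous_real_toNNReal.tendsto 0
      rw [Real.toNNReal_zero] at this
      exact this.mono_left nhdsWithin_le_nhds
    · filter_upwards [self_mem_nhdsWithin] with u hu
      exact Real.toNNReal_pos.2 hu
  obtain ⟨A, hA⟩ := exists_eq_exp_of_semigroup (m := fun t : ℝ => X.cexpMoment z t.toNNReal)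
    (by simp only [Real.toNNReal_zero]; exact X.cexpMoment_zero z)
    (fun s t hs ht => by rw [Real.toNNReal_add hs ht, X.cexpMoment_add hfin])
    ((X.tendsto_cexpMoment hfin).comp htend)
  refine ⟨A, (X.isMatrixExponent_iff z A).2 ⟨hfin, fun t => ?_⟩⟩
  have h := hA t t.2
  simp only [Real.toNNReal_coe] at h
  rw [h]
  congr 1

theorem isMatrixExponent_matrixExponent (X : MarkovAdditiveProcess E Ω) {z : ℂ}
    (hfin : ∀ t α β, X.expMoment z.re t α β ≠ ⊤) :
    X.IsMatrixExponent z (X.matrixExponent z) := by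
  have h := X.exists_isMatrixExponent hfin
  rw [matrixExponent, dif_pos h]
  exact h.choose_spec

end Moments

end MarkovAdditiveProcess

/-! ### Positivity and propagation of finiteness under irreducibility. -/

namespace MarkovAdditiveProcess

section Finiteness

variable {E Ω : Type*} [Fintype E] [DecidableEq E] [MeasurableSpace E] [MeasurableSingletonClass E]
  [MeasurableSpace Ω]

/-- The exponential is positive, so vanishing does not depend on θ and can be tested at θ = 0. -/
theorem expMoment_eq_zero_iff (X : MarkovAdditiveProcess E Ω) (θ : ℝ) (t : ℝ≥0) (α β : E) :
    X.expMoment θ t α β = 0 ↔ X.P α 0 {ω | X.J t ω = β} = 0 := by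
  rw [expMoment_eq_lintegral, lintegral_eq_zero_iff (by fun_prop), ← Measure.restrict_eq_zero,
    ← ae_eq_bot, ← eventually_false_iff_eq_bot]
  refine eventually_congr (Eventually.of_forall fun ω => ?_)
  simp [Real.exp_pos]

theorem expMoment_mul_le (X : MarkovAdditiveProcess E Ω) (θ : ℝ) (t s : ℝ≥0) (α γ β : E) :
    X.expMoment θ t α γ * X.expMoment θ s γ β ≤ X.expMoment θ (t + s) α β := by
  rw [expMoment_add, Matrix.mul_apply]
  exact Finset.single_le_sum (f := fun γ => X.expMoment θ t α γ * X.expMoment θ s γ β)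
    (fun _ _ => zero_le) (Finset.mem_univ γ)

theorem expMoment_zero_order_ne_top (X : MarkovAdditiveProcess E Ω) (t : ℝ≥0) (α β : E) :
    X.expMoment 0 t α β ≠ ⊤ := by
  rw [expMoment_apply]
  simp

theorem expMoment_zero_time (X : MarkovAdditiveProcess E Ω) (θ : ℝ) (α β : E) :
    X.expMoment θ 0 α β = (1 : Matrix E E ENNReal) α β := by
  rw [expMoment_apply, stateLaw_zero]
  rcases eq_or_ne α β with rfl | h
  · simp
  · simp [h]

/-- A property which holds on `[0, δ]` and is additive holds everywhere. -/
theorem forall_of_forall_le_of_add {p : ℝ≥0 → Prop} {δ : ℝ≥0} (hδ : 0 < δ)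
    (h : ∀ t ≤ δ, p t) (hadd : ∀ t s, p t → p s → p (t + s)) (t : ℝ≥0) : p t := by
  have key : ∀ n : ℕ, ∀ t ≤ (n + 1) • δ, p t := by
    intro n
    induction n with
    | zero => simpa using h
    | succ n ih =>
      intro t ht
      rcases le_total t δ with h' | h'
      · exact h t h'
      · rw [← tsub_add_cancel_of_le h']
        refine hadd _ _ (ih _ ?_) (h δ le_rfl)
        rw [tsub_le_iff_right, ← succ_nsmul]
        exact ht
  obtain ⟨n, hn⟩ := Archimedean.arch t hδ
  exact key n t (hn.trans (nsmul_le_nsmul_left zero_le (Nat.le_succ n)))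

theorem expMoment_diag_ne_zero (X : MarkovAdditiveProcess E Ω) (θ : ℝ) (t : ℝ≥0) (α : E) :
    X.expMoment θ t α α ≠ 0 := by
  obtain ⟨δ, hδ, hδ'⟩ := mem_nhdsGT_iff_exists_Ioc_subset.1
    (eventually_lt_of_lt_liminf (zero_lt_one.trans_le (X.one_le_liminf_expMoment θ α)))
  refine forall_of_forall_le_of_add (p := fun t => X.expMoment θ t α α ≠ 0) hδ (fun t ht => ?_)
    (fun t s ht hs => ?_) t
  · rcases eq_or_lt_of_le (zero_le : 0 ≤ t) with rfl | h
    · simp [expMoment_zero_time]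
    · exact (hδ' ⟨h, ht⟩ : 0 < X.expMoment θ t α α).ne'
  · exact ((pos_iff_ne_zero.2 (mul_ne_zero ht hs)).trans_le (X.expMoment_mul_le θ t s α α α)).ne'

open scoped Matrix.Norms.Operator in
theorem analyticOnNhd_exp_smul_apply (Q : Matrix E E ℂ) (α β : E) :
    AnalyticOnNhd ℝ (fun u : ℝ => (NormedSpace.exp (u • Q) : Matrix E E ℂ) α β) univ := by
  intro u _
  have h1 : AnalyticAt ℝ (fun u : ℝ => u • Q) u := analyticAt_id.smul analyticAt_const
  have h2 : AnalyticAt ℝ (fun u : ℝ => (NormedSpace.exp (u • Q) : Matrix E E ℂ)) u :=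
    AnalyticAt.fun_comp (NormedSpace.exp_analytic (𝕂 := ℝ) (u • Q)) h1
  exact ((LinearMap.toContinuousLinearMap (Matrix.entryLinearMap ℝ ℂ α β)).analyticAt _).fun_comp h2

/-- For an irreducible chain, every state is reached with positive probability at every positive
time. -/
theorem IsIrreducible.expMoment_ne_zero {X : MarkovAdditiveProcess E Ω} (hX : X.IsIrreducible)
    (θ : ℝ) {t : ℝ≥0} (ht : 0 < t) (α β : E) : X.expMoment θ t α β ≠ 0 := by
  rw [Ne, expMoment_eq_zero_iff, ← X.expMoment_eq_zero_iff 0]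
  intro h0
  obtain ⟨Q, hQ⟩ := X.exists_isMatrixExponent (z := 0) (by
    simpa using X.expMoment_zero_order_ne_top)
  have hQ' : ∀ u : ℝ≥0, (NormedSpace.exp ((u : ℝ) • Q) : Matrix E E ℂ) α β
      = ((X.P α 0).real {ω | X.J u ω = β} : ℂ) := by
    intro u
    have h1 := ((X.isMatrixExponent_iff 0 Q).1 hQ).2 u
    have h2 : ((u : ℝ) • Q : Matrix E E ℂ) = (u : ℂ) • Q := rfl
    rw [h2, ← h1, cexpMoment_eq_integral]
    simp
  -- Having reached β at time u, the chain is again at β at time t with positive probability; a zero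
  -- at t therefore spreads to all of [0, t]. As the transition probabilities are entries of exp (u
  -- Q), analytic in u, they would vanish at all times.
  have hzero : ∀ u ≤ t, X.expMoment 0 u α β = 0 := by
    intro u hu
    have h1 := X.expMoment_mul_le 0 u (t - u) α β β
    rw [add_tsub_cancel_of_le hu, h0, nonpos_iff_eq_zero, mul_eq_zero] at h1
    exact h1.resolve_right (X.expMoment_diag_ne_zero 0 _ β)
  have ht' : (0 : ℝ) < t := ht
  have hev : (fun u : ℝ => (NormedSpace.exp (u • Q) : Matrix E E ℂ) α β) =ᶠ[𝓝 ((t : ℝ) / 2)] 0 := by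
    filter_upwards [Ioo_mem_nhds (half_pos ht') (half_lt_self ht')] with u hu
    have h1 := hQ' ⟨u, hu.1.le⟩
    have h2 := (X.expMoment_eq_zero_iff 0 _ α β).1 (hzero ⟨u, hu.1.le⟩ hu.2.le)
    rw [measureReal_def, h2] at h1
    rw [ENNReal.toReal_zero, Complex.ofReal_zero] at h1
    exact h1
  have hall := (analyticOnNhd_exp_smul_apply Q α β).eqOn_zero_of_preconnected_of_eventuallyEq_zero
    isPreconnected_univ (mem_univ _) hev
  obtain ⟨u, -, hu⟩ := hX α β
  have h1 := hall (mem_univ (u : ℝ))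
  simp only [hQ' u, Pi.zero_apply, Complex.ofReal_eq_zero, measureReal_def] at h1
  exact (ENNReal.toReal_pos hu.ne' (measure_ne_top _ _)).ne' h1

/-- If, from one starting state, the exponential moment at one positive time is finite, then all
exponential moments of this order are finite. -/
theorem IsIrreducible.expMoment_ne_top {X : MarkovAdditiveProcess E Ω} (hX : X.IsIrreducible)
    {θ : ℝ} {T : ℝ≥0} (hT : 0 < T) {α₀ : E} (h : ∀ β, X.expMoment θ T α₀ β ≠ ⊤)
    (t : ℝ≥0) (α β : E) : X.expMoment θ t α β ≠ ⊤ := by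
  revert α β
  refine forall_of_forall_le_of_add (p := fun t => ∀ α β, X.expMoment θ t α β ≠ ⊤) (half_pos hT)
    (fun u hu γ β htop => ?_) (fun t s ht hs α β => ?_) t
  · have huT : u < T := hu.trans_lt (half_lt_self hT)
    have h1 := X.expMoment_mul_le θ (T - u) u α₀ γ β
    rw [tsub_add_cancel_of_le huT.le, htop,
      ENNReal.mul_top (hX.expMoment_ne_zero θ (tsub_pos_of_lt huT) α₀ γ)] at h1
    exact h β (top_le_iff.1 h1)
  · rw [expMoment_add, Matrix.mul_apply]
    exact ENNReal.sum_ne_top.2 fun γ _ => ENNReal.mul_ne_top (ht α γ) (hs γ β)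

/-- Moving the start from x to 0 only multiplies the moment by e^{-θx}. -/
theorem expMoment_ne_top_of_integrable_Y_rpow (X : MarkovAdditiveProcess E Ω) {θ x : ℝ} {T : ℝ≥0}
    {α : E} (h : Integrable (fun ω => X.Y T ω ^ θ) (X.P α x)) (β : E) :
    X.expMoment θ T α β ≠ ⊤ := by
  have h1 : Integrable (fun u : ℝ => Real.exp (θ * u)) (∑ β, X.stateLaw T α β) := by
    rw [← X.map_ξ_sub_initial T α x, integrable_map_measure (by fun_prop) (by fun_prop)]
    refine (h.mul_const (Real.exp (-θ * x))).congr (Eventually.of_forall fun ω => ?_)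
    simp only [Y, Function.comp]
    rw [← Real.exp_mul, ← Real.exp_add]
    ring_nf
  have h2 := (integrable_finsetSum_measure.1 h1 β (Finset.mem_univ β)).2
  rw [expMoment_apply]
  refine ne_of_lt (lt_of_le_of_lt (le_of_eq ?_) h2)
  refine lintegral_congr fun u => ?_
  rw [Real.enorm_of_nonneg (Real.exp_pos _).le]

end Finiteness

end MarkovAdditiveProcess

/-! ### Mellin transforms of multiplicative mixtures -/

/-- Dividing the integrand by the nonvanishing power recovers f; no measurability of the payoff is
assumed elsewhere. -/
theorem MellinConvergent.aestronglyMeasurable {f : ℝ → ℂ} {z : ℂ} (hf : MellinConvergent f z) :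
    AEStronglyMeasurable f (volume.restrict (Ioi 0)) := by
  have h1 : AEStronglyMeasurable (fun t : ℝ => (t : ℂ) ^ (-(z - 1)))
      (volume.restrict (Ioi 0)) := by
    refine ContinuousOn.aestronglyMeasurable (fun t ht => ?_) measurableSet_Ioi
    exact (Complex.continuousAt_ofReal_cpow_const t _ (Or.inr (ne_of_gt ht))).continuousWithinAt
  refine (h1.mul hf.1).congr ?_
  filter_upwards [ae_restrict_mem measurableSet_Ioi] with t ht
  have ht' : (t : ℂ) ≠ 0 := Complex.ofReal_ne_zero.2 (ne_of_gt ht)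
  simp only [Pi.mul_apply, smul_eq_mul]
  rw [← mul_assoc, ← Complex.cpow_add _ _ ht']
  simp

theorem MellinConvergent.of_re_eq {f : ℝ → ℂ} {z w : ℂ} (hf : MellinConvergent f z)
    (h : w.re = z.re) : MellinConvergent f w := by
  have hm := hf.aestronglyMeasurable
  rw [MellinConvergent, mellin_convergent_iff_norm subset_rfl measurableSet_Ioi hm] at hf ⊢
  rwa [h]

theorem quasiMeasurePreserving_exp_mul (ν : Measure ℝ) [SFinite ν] :
    Measure.QuasiMeasurePreserving (fun p : ℝ × ℝ => Real.exp p.2 * p.1)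
      ((volume.restrict (Ioi 0)).prod ν) (volume.restrict (Ioi 0)) := by
  refine QuasiMeasurePreserving.prod_of_left (by fun_prop) (Eventually.of_forall fun u => ?_)
  have h1 : Measure.QuasiMeasurePreserving (fun y : ℝ => Real.exp u * y) volume volume := by
    refine ⟨by fun_prop, ?_⟩
    rw [Real.map_volume_mul_left (Real.exp_pos u).ne']
    exact Measure.smul_absolutelyContinuous
  exact h1.restrict fun y hy => mul_pos (Real.exp_pos u) hy

/-- For a given y, the law of e^u y may charge the null set where f differs from its measurable
version; by Fubini this happens only for a null set of y. -/
theorem ae_aestronglyMeasurable_map_exp_mul {f : ℝ → ℂ}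
    (hf : AEStronglyMeasurable f (volume.restrict (Ioi 0))) (ν : Measure ℝ) [SFinite ν] :
    ∀ᵐ y ∂(volume.restrict (Ioi (0 : ℝ))),
      AEStronglyMeasurable f (ν.map fun u => Real.exp u * y) := by
  obtain ⟨g, hg, hfg⟩ := hf
  obtain ⟨N, hN, hNm, hN0⟩ := exists_measurable_superset_of_null hfg
  have h1 := (quasiMeasurePreserving_exp_mul ν).preimage_null hN0
  have h2 := Measure.measure_ae_null_of_prod_null h1
  filter_upwards [h2] with y hy
  refine ⟨g, hg, ?_⟩
  have h3 : (ν.map fun u => Real.exp u * y) N = 0 := by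
    rw [Measure.map_apply (by fun_prop) hNm]
    exact hy
  exact measure_mono_null hN h3

theorem cpow_exp_ofReal (u : ℝ) (z : ℂ) :
    ((Real.exp u : ℝ) : ℂ) ^ z = Complex.exp (z * (u : ℂ)) := by
  rw [Complex.cpow_def_of_ne_zero (Complex.ofReal_ne_zero.2 (Real.exp_pos u).ne'),
    ← Complex.ofReal_log (Real.exp_pos u).le, Real.log_exp, mul_comm]

/-- Scaling y by e^u turns the L¹ norm in y into |e^{-zu}| times a constant, which ν integrates. -/
theorem integrable_mellin_kernel {f : ℝ → ℂ} {z : ℂ} (hf : MellinConvergent f z)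
    {ν : Measure ℝ} [SFinite ν] (hν : Integrable (fun u : ℝ => Complex.exp (-z * (u : ℂ))) ν) :
    Integrable (fun p : ℝ × ℝ => (p.1 : ℂ) ^ (z - 1) • f (Real.exp p.2 * p.1))
      ((volume.restrict (Ioi 0)).prod ν) := by
  have hm := hf.aestronglyMeasurable
  have h1 : AEStronglyMeasurable (fun t : ℝ => (t : ℂ) ^ (z - 1)) (volume.restrict (Ioi 0)) := by
    refine ContinuousOn.aestronglyMeasurable (fun t ht => ?_) measurableSet_Ioi
    exact (Complex.continuousAt_ofReal_cpow_const t _ (Or.inr (ne_of_gt ht))).continuousWithinAt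
  have hK : AEStronglyMeasurable
      (fun p : ℝ × ℝ => (p.1 : ℂ) ^ (z - 1) • f (Real.exp p.2 * p.1))
      ((volume.restrict (Ioi 0)).prod ν) :=
    h1.comp_fst.smul (hm.comp_quasiMeasurePreserving (quasiMeasurePreserving_exp_mul ν))
  refine (integrable_prod_iff' hK).2 ⟨Eventually.of_forall fun u =>
    (MellinConvergent.comp_mul_left (Real.exp_pos u)).2 hf, ?_⟩
  set g : ℝ → ℝ := fun t => ‖(t : ℂ) ^ (z - 1) • f t‖ with hg
  have h2 : ∀ u : ℝ, ∫ y in Ioi (0 : ℝ), ‖(y : ℂ) ^ (z - 1) • f (Real.exp u * y)‖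
      = ‖Complex.exp (-z * (u : ℂ))‖ * ∫ y in Ioi (0 : ℝ), g y := by
    intro u
    have hc := Real.exp_pos u
    have e1 : ∀ y ∈ Ioi (0 : ℝ), ‖(y : ℂ) ^ (z - 1) • f (Real.exp u * y)‖
        = Real.exp (-(z.re - 1) * u) * g (Real.exp u * y) := by
      intro y hy
      have hy' : (0 : ℝ) < y := hy
      simp only [hg, norm_smul]
      rw [Complex.norm_cpow_eq_rpow_re_of_pos hy', Complex.norm_cpow_eq_rpow_re_of_pos
        (mul_pos hc hy'), Real.mul_rpow hc.le hy'.le, ← Real.exp_mul, ← mul_assoc, ← mul_assoc,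
        ← Real.exp_add]
      simp only [Complex.sub_re, Complex.one_re]
      ring_nf
      simp
    rw [setIntegral_congr_fun measurableSet_Ioi e1, integral_const_mul,
      integral_comp_mul_left_Ioi g 0 hc, mul_zero, smul_eq_mul, ← mul_assoc, Complex.norm_exp,
      ← Real.exp_neg, ← Real.exp_add]
    congr 2
    simp
    ring
  simp_rw [h2]
  exact hν.norm.mul_const _

/-- The Mellin transform of the multiplicative mixture `y ↦ ∫ f (e^u y) dν(u)`. -/
theorem hasMellin_integral_exp_mul {f : ℝ → ℂ} {z : ℂ} (hf : MellinConvergent f z)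
    {ν : Measure ℝ} [SFinite ν] (hν : Integrable (fun u : ℝ => Complex.exp (-z * (u : ℂ))) ν) :
    HasMellin (fun y => ∫ u, f (Real.exp u * y) ∂ν) z
      (mellin f z * ∫ u : ℝ, Complex.exp (-z * (u : ℂ)) ∂ν) := by
  have hK := integrable_mellin_kernel hf hν
  have e : (fun y : ℝ => (y : ℂ) ^ (z - 1) • ∫ u, f (Real.exp u * y) ∂ν)
      = fun y : ℝ => ∫ u, (y : ℂ) ^ (z - 1) • f (Real.exp u * y) ∂ν := by
    ext y
    rw [integral_smul]
  refine ⟨?_, ?_⟩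
  · rw [MellinConvergent, e]
    exact hK.integral_prod_left
  · rw [mellin, e, integral_integral_swap hK, ← integral_const_mul]
    refine integral_congr_ae (Eventually.of_forall fun u => ?_)
    have := mellin_comp_mul_left f z (Real.exp_pos u)
    rw [mellin] at this
    simp only [this]
    rw [cpow_exp_ofReal, smul_eq_mul, mul_comm]

theorem ae_integrable_comp_exp_mul {f : ℝ → ℂ} {z : ℂ} (hf : MellinConvergent f z)
    {ν : Measure ℝ} [SFinite ν] (hν : Integrable (fun u : ℝ => Complex.exp (-z * (u : ℂ))) ν) :
    ∀ᵐ y ∂(volume.restrict (Ioi (0 : ℝ))), Integrable f (ν.map fun u => Real.exp u * y) := by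
  filter_upwards [(integrable_mellin_kernel hf hν).prod_right_ae,
    ae_aestronglyMeasurable_map_exp_mul hf.aestronglyMeasurable ν,
    ae_restrict_mem measurableSet_Ioi] with y hy hm hpos
  rw [integrable_map_measure hm (by fun_prop)]
  have hne : (y : ℂ) ^ (z - 1) ≠ 0 := by
    rw [Ne, Complex.cpow_eq_zero_iff, not_and_or]
    exact Or.inl (Complex.ofReal_ne_zero.2 (ne_of_gt hpos))
  exact (integrable_smul_iff hne _).1 hy

/-! ### The law of the price and the Mellin transform of the option price. -/

namespace MarkovAdditiveProcess

variable {E Ω : Type*} [Fintype E] [DecidableEq E] [MeasurableSpace E] [MeasurableSingletonClass E]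
  [MeasurableSpace Ω]

theorem measurable_Y (X : MarkovAdditiveProcess E Ω) (t : ℝ≥0) : Measurable (X.Y t) :=
  Real.measurable_exp.comp (X.measurable_ξ t)

theorem map_Y (X : MarkovAdditiveProcess E Ω) (t : ℝ≥0) (α : E) {y : ℝ} (hy : 0 < y) :
    (X.P α (Real.log y)).map (X.Y t)
      = (∑ β, X.stateLaw t α β).map (fun u => Real.exp u * y) := by
  rw [← X.map_ξ_sub_initial t α (Real.log y), Measure.map_map (by fun_prop) (by fun_prop)]
  congr 1
  ext ω
  simp only [Function.comp, Y]
  rw [Real.exp_sub, Real.exp_log hy, div_mul_cancel₀ _ hy.ne']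

end MarkovAdditiveProcess

theorem mainTheorem3 {E Ω : Type*} [Fintype E] [DecidableEq E] [MeasurableSpace E]
    [MeasurableSingletonClass E] [MeasurableSpace Ω]
    (X : MarkovAdditiveProcess E Ω) (hX : X.IsIrreducible)
    (r : ℝ) (T : ℝ≥0) (H : ℝ → ℝ) (s : ℝ)
    (hmom : ∃ (α₀ : E) (y₀ : ℝ), 0 < y₀ ∧
      Integrable (fun ω => X.Y T ω ^ (-s)) (X.P α₀ (Real.log y₀)))
    (hH : MellinConvergent (fun x : ℝ => (H x : ℂ)) (s : ℂ))
    (α : E) :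
    (∀ᵐ y ∂(volume.restrict (Ioi (0 : ℝ))),
      Integrable (fun ω => H (X.Y T ω)) (X.P α (Real.log y))) ∧
    ∀ z : ℂ, z.re = s →
      (0 < T → X.IsMatrixExponent (-z) (X.matrixExponent (-z))) ∧
      HasMellin (fun y : ℝ => (X.europeanPrice r H α y T : ℂ)) z
        (Complex.exp (-(r : ℂ) * (T : ℂ)) * mellin (fun x : ℝ => (H x : ℂ)) z *
          ∑ β : E, (NormedSpace.exp ((T : ℂ) • X.matrixExponent (-z)) : Matrix E E ℂ) α β) := by
  obtain ⟨α₀, y₀, -, hY⟩ := hmom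
  have hfinpos : 0 < T → ∀ t α β, X.expMoment (-s) t α β ≠ ⊤ := fun hT =>
    hX.expMoment_ne_top hT (X.expMoment_ne_top_of_integrable_Y_rpow hY)
  have hfin : ∀ β, X.expMoment (-s) T α β ≠ ⊤ := by
    -- At T = 0 the hypothesis gives no information on later moments, but only the moment matrix at
    -- time 0 is needed, and it is the identity.
    rcases eq_or_lt_of_le (zero_le : 0 ≤ T) with rfl | hT
    · intro β
      rw [X.expMoment_zero_time, Matrix.one_apply]
      split_ifs <;> simp
    · exact hfinpos hT T α
  have hint : ∀ z : ℂ, z.re = s →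
      Integrable (fun u : ℝ => Complex.exp (-z * (u : ℂ))) (∑ β, X.stateLaw T α β) := fun z hz =>
    integrable_finsetSum_measure.2 fun β _ => X.integrable_cexp_stateLaw (by simpa [hz] using hfin β)
  have hae : ∀ᵐ y ∂(volume.restrict (Ioi (0 : ℝ))),
      Integrable (fun x : ℝ => (H x : ℂ)) ((X.P α (Real.log y)).map (X.Y T)) := by
    filter_upwards [ae_integrable_comp_exp_mul hH (hint s (Complex.ofReal_re s)),
      ae_restrict_mem measurableSet_Ioi] with y hy hpos
    rwa [X.map_Y T α hpos]
  refine ⟨hae.mono fun y hy => (hy.comp_measurable (X.measurable_Y T)).re, fun z hz => ?_⟩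
  have hME : 0 < T → X.IsMatrixExponent (-z) (X.matrixExponent (-z)) := fun hT =>
    X.isMatrixExponent_matrixExponent (by simpa [hz] using hfinpos hT)
  refine ⟨hME, ?_⟩
  have hsum : ∫ u : ℝ, Complex.exp (-z * (u : ℂ)) ∂(∑ β, X.stateLaw T α β)
      = ∑ β, (NormedSpace.exp ((T : ℂ) • X.matrixExponent (-z)) : Matrix E E ℂ) α β := by
    rw [integral_finsetSum_measure (integrable_finsetSum_measure.1 (hint z hz))]
    refine Finset.sum_congr rfl fun β _ => ?_
    rw [← X.cexpMoment_apply]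
    -- For T = 0 the value of `matrixExponent`, possibly the default 0, is irrelevant: it is
    -- multiplied by 0 before exponentiation.
    rcases eq_or_lt_of_le (zero_le : 0 ≤ T) with rfl | hT
    · rw [X.cexpMoment_zero]
      simp
    · rw [((X.isMatrixExponent_iff _ _).1 (hME hT)).2 T]
  have hmel := hasMellin_integral_exp_mul (hH.of_re_eq (w := z) (by simpa using hz)) (hint z hz)
  rw [hsum] at hmel
  have hprice : (fun y : ℝ => (y : ℂ) ^ (z - 1) • (X.europeanPrice r H α y T : ℂ))
      =ᵐ[volume.restrict (Ioi 0)] fun y : ℝ => (y : ℂ) ^ (z - 1) •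
        (Complex.exp (-(r : ℂ) * (T : ℂ)) •
          ∫ u, (H (Real.exp u * y) : ℂ) ∂(∑ β, X.stateLaw T α β)) := by
    filter_upwards [hae, ae_restrict_mem measurableSet_Ioi] with y hy hpos
    have h1 : ∫ ω, (H (X.Y T ω) : ℂ) ∂(X.P α (Real.log y))
        = ∫ u, (H (Real.exp u * y) : ℂ) ∂(∑ β, X.stateLaw T α β) := by
      rw [← integral_map (X.measurable_Y T).aemeasurable hy.1]
      rw [X.map_Y T α hpos] at hy ⊢
      rw [integral_map (by fun_prop) hy.1]
    rw [← h1, MarkovAdditiveProcess.europeanPrice, integral_complex_ofReal]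
    push_cast
    rfl
  refine ⟨(hmel.1.const_smul (Complex.exp (-(r : ℂ) * (T : ℂ)))).congr hprice.symm, ?_⟩
  rw [mellin, integral_congr_ae hprice]
  have h2 := mellin_const_smul (fun y : ℝ => ∫ u, (H (Real.exp u * y) : ℂ)
    ∂(∑ β, X.stateLaw T α β)) z (Complex.exp (-(r : ℂ) * (T : ℂ)))
  rw [mellin, hmel.2] at h2
  rw [h2, smul_eq_mul, mul_assoc]
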